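/- Let \(R=\mathbb{F}_2[w_1,w_2,w_3,\dots]\) be the polynomial ring in countably many variables over \(\mathbb{F}_2\), and put \(w_0=1\). Let \(\omega\colon R\to R\), \(x\mapsto\overline{x}\), be the involutive \(\mathbb{F}_2\)-algebra endomorphism determined recursively by \(\overline{w}_0=1\) and \[\sum_{i=0}^{k} w_i\,\overline{w}_{k-i}=0\qquad(k\ge 1).\] (Equivalently, \(R\) is the ring of symmetric functions over \(\mathbb{F}_2\) and \(\omega\) is the standard involution interchanging the elementary and the complete homogeneous symmetric functions.) Let \(S=\{x\in R : \overline{x}=x\}\) be the subring of \(\omega\)-invariant elements, and let \(I=\{x+\overline{x} : x\in R\}\), which is an ideal of \(S\). Let \(I^2\) be the square of \(I\) as an ideal of \(S\), and let \(RI^2\) be the ideal of \(R\) generated by \(I^2\). Then \(\omega\) is \(2\)-transverse, that is, \[RI^2\cap S=I^2.\] -/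

import Mathlib

namespace ThickDiff

/-! Commutative `𝔽₂`-algebras with an involution. -/

section General

variable {A : Type*} [CommRing A] [Algebra (ZMod 2) A]

/-- The subalgebra `S = A^ω` of `ω`-invariant elements. -/
def invariants (ω : A →ₐ[ZMod 2] A) : Subalgebra (ZMod 2) A :=
  AlgHom.equalizer ω (AlgHom.id (ZMod 2) A)

/-- The ideal `I = { x + ω x | x ∈ A }` of `S`. When `ω` is an involution, every element `x + ω x`
of `A` lies in `S` (see `add_apply_mem_invariants`). -/
def diffIdeal (ω : A →ₐ[ZMod 2] A) : Ideal (invariants ω) where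
  carrier := {s | ∃ x : A, (s : A) = x + ω x}
  zero_mem' := ⟨0, by simp⟩
  add_mem' := by
    rintro a b ⟨x, hx⟩ ⟨y, hy⟩
    refine ⟨x + y, ?_⟩
    rw [Subalgebra.coe_add, hx, hy, map_add]
    ring
  smul_mem' := by
    rintro c a ⟨x, hx⟩
    have hc : ω (c : A) = c := c.2
    refine ⟨c * x, ?_⟩
    rw [smul_eq_mul, Subalgebra.coe_mul, hx, map_mul, hc]
    ring

theorem add_apply_mem_invariants {ω : A →ₐ[ZMod 2] A} (hω : Function.Involutive ω) (x : A) :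
    x + ω x ∈ invariants ω := by
  change ω (x + ω x) = x + ω x
  rw [map_add, hω x, add_comm]

/-- `ω` is `n`-transverse if `A Iⁿ ∩ S = Iⁿ`; here `A Iⁿ` is the extension to `A` of the ideal `Iⁿ`
of `S`, and the intersection with `S` is the contraction to `S`. -/
def IsNTransverse (ω : A →ₐ[ZMod 2] A) (n : ℕ) : Prop :=
  ((diffIdeal ω ^ n).map (algebraMap (invariants ω) A)).comap (algebraMap (invariants ω) A)
    = diffIdeal ω ^ n

end General

/-! The polynomial ring `R = 𝔽₂[w₁, w₂, w₃, …]` and its involution `ω`. -/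

/-- `R = 𝔽₂[w₁, w₂, …]`; the variable `X k` is `w_{k+1}`. -/
abbrev R : Type := MvPolynomial ℕ (ZMod 2)

/-- The elements `w_k` of `R`, with the convention `w₀ = 1`. -/
noncomputable def w : ℕ → R
  | 0 => 1
  | k + 1 => MvPolynomial.X k

/-- The images `w̄_k`, given recursively by `w̄₀ = 1` and `∑_{i=0}^{k} w_i w̄_{k-i} = 0` for `k ≥ 1`
(see `sum_w_mul_wbar`), solved for `w̄_k`. -/
noncomputable def wbar : ℕ → R
  | 0 => 1
  | k + 1 => ∑ i : Fin (k + 1), w (i + 1) * wbar (k - i)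

/-- The endomorphism `ω` of `R` with `ω w_k = w̄_k`; it is an involution (`omega_involutive`). -/
noncomputable def omega : R →ₐ[ZMod 2] R :=
  MvPolynomial.aeval fun k => wbar (k + 1)

theorem omega_w (k : ℕ) : omega (w k) = wbar k := by
  cases k with
  | zero => simp [w, wbar]
  | succ k => simp [w, omega]

theorem sum_w_mul_wbar (k : ℕ) (hk : 1 ≤ k) :
    ∑ i ∈ Finset.range (k + 1), w i * wbar (k - i) = 0 := by
  obtain ⟨k, rfl⟩ : ∃ m, k = m + 1 := ⟨k - 1, by omega⟩
  rw [Finset.sum_range_succ', Finset.sum_range]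
  simp only [Nat.add_sub_add_right, Nat.sub_zero]
  rw [wbar, w, one_mul]
  exact CharTwo.add_self_eq_zero _

theorem omega_involutive : Function.Involutive omega := by
  have h1 : PowerSeries.mk w * PowerSeries.mk wbar = 1 := by
    ext1 k
    rw [PowerSeries.coeff_mul, Finset.Nat.sum_antidiagonal_eq_sum_range_succ_mk,
      PowerSeries.coeff_one]
    simp only [PowerSeries.coeff_mk]
    split_ifs with h
    · subst h
      simp [w, wbar]
    · exact sum_w_mul_wbar k (Nat.one_le_iff_ne_zero.mpr h)
  have h2 : PowerSeries.mk wbar * PowerSeries.mk (fun k => omega (wbar k)) = 1 := by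
    have h3 := congrArg (PowerSeries.map (omega : R →+* R)) h1
    rw [map_mul, map_one] at h3
    rw [← h3]
    congr 1
    ext1 k
    simp [omega_w]
  have h4 : PowerSeries.mk w = PowerSeries.mk (fun k => omega (wbar k)) := left_inv_eq_right_inv h1 h2
  have h5 : omega.comp omega = AlgHom.id (ZMod 2) R := by
    ext1 k
    have h6 := congrArg (PowerSeries.coeff (k + 1)) h4
    rw [PowerSeries.coeff_mk, PowerSeries.coeff_mk, ← omega_w] at h6
    exact h6.symm
  exact fun x => DFunLike.congr_fun h5 x

end ThickDiff

/-!
The defining relation of `w̄_k` is symmetric under `ω`. Its first half is therefore an element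
`c (k - 1)` that equals `w_k` up to decomposables, and that is invariant for odd `k`, while
`ω (c (2k+1)) = c (2k+1) + f k` with the norm `f k = w_{k+1} w̄_{k+1}`, an invariant element of `I`.

The products `β a M` of powers of the `f k` with distinct `c m` form a basis of `R` over `𝔽₂`
(`betaBasis`): they are weighted homogeneous, the parts of lowest total degree of `f k` and `c m`
are `w_{k+1}²` and `w_{m+1}`, and so the transition from monomials to the `β a M` is
unitriangular. In this basis `R`, as a vector space with involution, is the tensor product of the
factors `𝔽₂[f k] {1, c (2k+1)}` and of the factors `{1, c (2k)}` with trivial action. No squares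
of the `c m` enter, so that the action of `ω` on `β a M` is explicit. It also follows that `R Iⁿ`
is the span of the `β a M` with at least `n` factors `f k` (`exists_mem_betaSpan`,
`beta_mem_J_pow`).

The factor `𝔽₂[f k] {1, c (2k+1)}` is `𝔽₂` plus the free `𝔽₂[C₂]`-module on the elements
`c (2k+1) * f k ^ j`. Let `W k` be the tensor product of all other factors. Then an invariant `s`
is its component in `W k` plus `y + ω y`, where `y = halfProj k s` loses at most one factor
`f k` (`halfProj_add_conj`). For `s` in `R Iⁿ⁺¹` this `y` is in `R Iⁿ`, and then `y + ω y` is in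
`Iⁿ⁺¹` (`add_apply_mem_diffIdeal_pow`), because `r i + ω (r i) = i (r + ω r)` for `i ∈ Iⁿ`.
Removing one index `k` after the other leaves the component of `s` without any factor `f k`, which
is zero.
-/

namespace ThickDiff

open MvPolynomial

/-! ### The elements `f k` and `c k` -/

/-- The norm `w_{k+1} * w̄_{k+1}`. -/
noncomputable def f (k : ℕ) : R := w (k + 1) * wbar (k + 1)

/-- The sum of `w_i * w̄_{k+1-i}` over `0 ≤ i < (k+1)/2`. It equals `w_{k+1}` up to decomposable
elements. -/
noncomputable def c (k : ℕ) : R := ∑ i ∈ Finset.range ((k + 2) / 2), w i * wbar (k + 1 - i)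

theorem omega_wbar (k : ℕ) : omega (wbar k) = w k := by
  rw [← omega_w, omega_involutive]

theorem omega_f (k : ℕ) : omega (f k) = f k := by
  rw [f, map_mul, omega_w, omega_wbar, mul_comm]

/-- In the defining relation for `w̄_{2k+1}` the terms `i` and `2k+1-i` are exchanged by `ω`. -/
theorem omega_c_even (k : ℕ) : omega (c (2 * k)) = c (2 * k) := by
  rw [← CharTwo.add_eq_zero]
  have h := sum_w_mul_wbar (2 * k + 1) (by omega)
  rw [show 2 * k + 1 + 1 = (k + 1) + (k + 1) by ring, Finset.sum_range_add,
    ← Finset.sum_range_reflect (fun x => w (k + 1 + x) * _)] at h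
  rw [← h, c, map_sum, show (2 * k + 2) / 2 = k + 1 by omega, add_comm]
  congr 1
  refine Finset.sum_congr rfl fun i hi => ?_
  have hi := Finset.mem_range.1 hi
  rw [map_mul, omega_w, omega_wbar, mul_comm]
  congr 2 <;> omega

/-- In the defining relation for `w̄_{2k+2}` the terms `i` and `2k+2-i` are exchanged by `ω`; the
middle term, the norm of `w_{k+1}`, is left over. -/
theorem omega_c_odd (k : ℕ) : omega (c (2 * k + 1)) = c (2 * k + 1) + f k := by
  rw [← CharTwo.add_eq_zero]
  have h := sum_w_mul_wbar (2 * k + 2) (by omega)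
  rw [show 2 * k + 2 + 1 = (k + 1 + 1) + (k + 1) by ring, Finset.sum_range_add,
    Finset.sum_range_succ, ← Finset.sum_range_reflect (fun x => w (k + 1 + 1 + x) * _)] at h
  have e1 : ∑ j ∈ Finset.range (k + 1), w (k + 1 + 1 + (k + 1 - 1 - j)) *
      wbar (2 * k + 2 - (k + 1 + 1 + (k + 1 - 1 - j))) = omega (c (2 * k + 1)) := by
    rw [c, map_sum, show (2 * k + 1 + 2) / 2 = k + 1 by omega]
    refine Finset.sum_congr rfl fun i hi => ?_
    have hi := Finset.mem_range.1 hi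
    rw [map_mul, omega_w, omega_wbar, mul_comm]
    congr 2 <;> omega
  rw [e1, show 2 * k + 2 - (k + 1) = k + 1 by omega] at h
  rw [← h, c, show (2 * k + 1 + 2) / 2 = k + 1 by omega, f, add_comm]

/-! ### Leading monomials -/

/-- `HasLead x e` says that `x` is weighted homogeneous, where `w_k` has weight `k`, and that the
monomial with exponent `e` is the part of `x` of lowest total degree. -/
def HasLead (x : R) (e : ℕ →₀ ℕ) : Prop :=
  x - monomial e 1 ∈ idealOfVars ℕ (ZMod 2) ^ (e.degree + 1) ∧
    IsWeightedHomogeneous (fun k => k + 1) x (Finsupp.weight (fun k => k + 1) e)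

theorem HasLead.one : HasLead 1 0 :=
  ⟨by simp, by simpa using isWeightedHomogeneous_one _ _⟩

theorem HasLead.mem {x : R} {e : ℕ →₀ ℕ} (h : HasLead x e) :
    x ∈ idealOfVars ℕ (ZMod 2) ^ e.degree := by
  have h1 := (monomial_mem_pow_idealOfVars_iff e.degree e (one_ne_zero (α := ZMod 2))).2 le_rfl
  simpa using add_mem (Ideal.pow_le_pow_right (Nat.le_succ _) h.1) h1

theorem HasLead.mul {x y : R} {d e : ℕ →₀ ℕ} (hx : HasLead x d) (hy : HasLead y e) :
    HasLead (x * y) (d + e) := by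
  refine ⟨?_, by rw [map_add]; exact hx.2.mul hy.2⟩
  have h1 := (monomial_mem_pow_idealOfVars_iff e.degree e (one_ne_zero (α := ZMod 2))).2 le_rfl
  have h2 := Ideal.mul_mem_mul hx.mem hy.1
  have h3 := Ideal.mul_mem_mul hx.1 h1
  rw [← pow_add] at h2 h3
  rw [map_add]
  rw [add_right_comm] at h3
  rw [show monomial (d + e) (1 : ZMod 2) = monomial d 1 * monomial e 1 by simp, add_assoc]
  convert add_mem h2 h3 using 1
  ring

theorem HasLead.prod {ι : Type*} (s : Finset ι) {x : ι → R} {e : ι → ℕ →₀ ℕ}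
    (h : ∀ i ∈ s, HasLead (x i) (e i)) : HasLead (∏ i ∈ s, x i) (∑ i ∈ s, e i) := by
  classical
  induction s using Finset.induction_on with
  | empty => simpa using HasLead.one
  | insert i s hi ih =>
    rw [Finset.prod_insert hi, Finset.sum_insert hi]
    exact (h i (by simp)).mul (ih fun j hj => h j (by simp [hj]))

theorem HasLead.pow {x : R} {e : ℕ →₀ ℕ} (h : HasLead x e) (n : ℕ) :
    HasLead (x ^ n) (n • e) := by
  simpa using HasLead.prod (Finset.range n) (x := fun _ => x) (e := fun _ => e) fun _ _ => h

theorem HasLead.add {x y : R} {e : ℕ →₀ ℕ} (h : HasLead x e)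
    (hy : y ∈ idealOfVars ℕ (ZMod 2) ^ (e.degree + 1))
    (hw : IsWeightedHomogeneous (fun k => k + 1) y (Finsupp.weight (fun k => k + 1) e)) :
    HasLead (x + y) e :=
  ⟨by rw [add_sub_right_comm]; exact add_mem h.1 hy, h.2.add hw⟩

theorem hasLead_w_succ (k : ℕ) : HasLead (w (k + 1)) (Finsupp.single k 1) := by
  refine ⟨by simp [w, X], ?_⟩
  simpa [w, Finsupp.weight_single] using isWeightedHomogeneous_X (ZMod 2) (fun k : ℕ => k + 1) k

theorem isWeightedHomogeneous_w (k : ℕ) : IsWeightedHomogeneous (fun k => k + 1) (w k) k := by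
  cases k with
  | zero => exact isWeightedHomogeneous_one _ _
  | succ k => exact isWeightedHomogeneous_X _ _ _

theorem isWeightedHomogeneous_wbar (k : ℕ) :
    IsWeightedHomogeneous (fun k => k + 1) (wbar k) k := by
  induction k using Nat.strong_induction_on with
  | _ k ih =>
    cases k with
    | zero => rw [wbar]; exact isWeightedHomogeneous_one _ _
    | succ k =>
      rw [wbar]
      refine IsWeightedHomogeneous.sum _ _ _ fun i _ => ?_
      convert (isWeightedHomogeneous_w (i + 1)).mul (ih (k - i) (by omega)) using 1
      omega

theorem w_succ_mem (k : ℕ) : w (k + 1) ∈ idealOfVars ℕ (ZMod 2) := by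
  simpa using (hasLead_w_succ k).mem

theorem wbar_succ_mem (k : ℕ) : wbar (k + 1) ∈ idealOfVars ℕ (ZMod 2) := by
  rw [wbar]
  exact sum_mem fun i _ => Ideal.mul_mem_right _ _ (w_succ_mem _)

theorem hasLead_wbar_succ (k : ℕ) : HasLead (wbar (k + 1)) (Finsupp.single k 1) := by
  rw [wbar, Fin.sum_univ_castSucc, add_comm]
  simp only [Fin.val_last, Fin.val_castSucc, Nat.sub_self]
  refine HasLead.add (by simpa [wbar] using hasLead_w_succ k) (sum_mem fun i _ => ?_)
    (.sum _ _ _ fun i _ => ?_)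
  · obtain ⟨j, hj⟩ : ∃ j, k - (i : ℕ) = j + 1 := ⟨k - i - 1, by omega⟩
    rw [hj, Finsupp.degree_single, pow_two]
    exact Ideal.mul_mem_mul (w_succ_mem _) (wbar_succ_mem _)
  · convert (isWeightedHomogeneous_w (i + 1)).mul (isWeightedHomogeneous_wbar (k - i)) using 1
    rw [Finsupp.weight_single, one_smul]
    omega

theorem hasLead_f (k : ℕ) : HasLead (f k) (Finsupp.single k 2) := by
  simpa [f, ← Finsupp.single_add] using (hasLead_w_succ k).mul (hasLead_wbar_succ k)

theorem hasLead_c (k : ℕ) : HasLead (c k) (Finsupp.single k 1) := by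
  rw [c, show (k + 2) / 2 = k / 2 + 1 by omega, Finset.sum_range_succ', add_comm]
  refine HasLead.add (by simpa [w] using hasLead_wbar_succ k) (sum_mem fun i hi => ?_)
    (.sum _ _ _ fun i hi => ?_)
  · have hi := Finset.mem_range.1 hi
    obtain ⟨j, hj⟩ : ∃ j, k + 1 - (i + 1) = j + 1 := ⟨k - i - 1, by omega⟩
    rw [hj, Finsupp.degree_single, pow_two]
    exact Ideal.mul_mem_mul (w_succ_mem _) (wbar_succ_mem _)
  · have hi := Finset.mem_range.1 hi
    convert (isWeightedHomogeneous_w (i + 1)).mul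
      (isWeightedHomogeneous_wbar (k + 1 - (i + 1))) using 1
    rw [Finsupp.weight_single, one_smul]
    omega

/-! ### The basis `β` -/

/-- The product of the `f i ^ a i` and of the `c i` for `i ∈ M`. -/
noncomputable def β (a : ℕ →₀ ℕ) (M : Finset ℕ) : R := a.prod (fun i n => f i ^ n) * ∏ i ∈ M, c i

/-- The exponent of the leading monomial of `β a M`. -/
noncomputable def leadExponent (a : ℕ →₀ ℕ) (M : Finset ℕ) : ℕ →₀ ℕ :=
  a.sum (fun i n => n • Finsupp.single i 2) + ∑ i ∈ M, Finsupp.single i 1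

theorem leadExponent_apply (a : ℕ →₀ ℕ) (M : Finset ℕ) (j : ℕ) :
    leadExponent a M j = 2 * a j + if j ∈ M then 1 else 0 := by
  simp [leadExponent, Finsupp.sum, Finsupp.single_apply, mul_comm]

/-- Every exponent is uniquely `2 a` plus the indicator function of a finite set. -/
noncomputable def leadExponentEquiv : (ℕ →₀ ℕ) × Finset ℕ ≃ (ℕ →₀ ℕ) where
  toFun p := leadExponent p.1 p.2
  invFun e := (e.mapRange (· / 2) rfl, e.support.filter fun i => Odd (e i))
  left_inv := by
    rintro ⟨a, M⟩
    ext j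
    · simp only [Finsupp.mapRange_apply, leadExponent_apply]
      split_ifs <;> omega
    · simp only [Finset.mem_filter, Finsupp.mem_support_iff, leadExponent_apply, Nat.odd_iff]
      split_ifs <;> simp_all
  right_inv e := by
    ext j
    simp only [leadExponent_apply, Finsupp.mapRange_apply, Finset.mem_filter,
      Finsupp.mem_support_iff, Nat.odd_iff]
    split_ifs <;> omega

theorem hasLead_beta (p : (ℕ →₀ ℕ) × Finset ℕ) : HasLead (β p.1 p.2) (leadExponentEquiv p) :=
  (HasLead.prod _ fun i _ => (hasLead_f i).pow _).mul (HasLead.prod _ fun i _ => hasLead_c i)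

theorem bijective_one_add_of_locally_nilpotent {K V : Type*} [Ring K] [AddCommGroup V] [Module K V]
    (N : V →ₗ[K] V) (h : ∀ x, ∃ n, (N ^ n) x = 0) : Function.Bijective (1 + N : V →ₗ[K] V) := by
  constructor
  · rw [injective_iff_map_eq_zero]
    intro x hx
    obtain ⟨n, hn⟩ := h x
    have h1 : N x = -x := (neg_eq_of_add_eq_zero_right hx).symm
    have h2 : ∀ m, (N ^ m) x = (-1) ^ m • x := by
      intro m
      induction m with
      | zero => simp
      | succ m ih => rw [pow_succ, Module.End.mul_apply, h1, map_neg, ih, pow_succ]; simp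
    have h3 := h2 n
    rw [hn] at h3
    rcases neg_one_pow_eq_or ℤ n with h4 | h4 <;> simpa [h4] using h3.symm
  · intro x
    obtain ⟨n, hn⟩ := h x
    refine ⟨(∑ i ∈ Finset.range n, (-N) ^ i) x, ?_⟩
    have h1 := mul_neg_geom_sum (-N) n
    rw [sub_neg_eq_add] at h1
    rw [← Module.End.mul_apply, h1, neg_pow]
    simp [hn]

/-- The monomials, indexed like the elements `β a M` of which they are the leading monomials. -/
noncomputable def leadBasis : Module.Basis ((ℕ →₀ ℕ) × Finset ℕ) (ZMod 2) R :=
  (basisMonomials ℕ (ZMod 2)).reindex leadExponentEquiv.symm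

/-- The linear map that sends the leading monomial of `β a M` to `β a M`. -/
noncomputable def leadToBeta : Module.End (ZMod 2) R :=
  leadBasis.constr (ZMod 2) fun p => β p.1 p.2

theorem leadToBeta_monomial (e : ℕ →₀ ℕ) : HasLead (leadToBeta (monomial e 1)) e := by
  obtain ⟨p, rfl⟩ := leadExponentEquiv.surjective e
  have h : leadBasis p = monomial (leadExponentEquiv p) 1 := by simp [leadBasis]
  rw [← h, leadToBeta, Module.Basis.constr_basis]
  exact hasLead_beta p

/-- The map `leadToBeta - 1` preserves the weight and raises the lowest total degree. -/
theorem leadToBeta_sub_one_mem {d n : ℕ} {x : R}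
    (hw : IsWeightedHomogeneous (fun k => k + 1) x d) (hx : x ∈ idealOfVars ℕ (ZMod 2) ^ n) :
    IsWeightedHomogeneous (fun k => k + 1) ((leadToBeta - 1) x) d ∧
      (leadToBeta - 1) x ∈ idealOfVars ℕ (ZMod 2) ^ (n + 1) := by
  rw [mem_pow_idealOfVars_iff] at hx
  rw [x.as_sum, map_sum]
  have key : ∀ e ∈ x.support, IsWeightedHomogeneous (fun k => k + 1)
      ((leadToBeta - 1) (monomial e (coeff e x))) d ∧
      (leadToBeta - 1) (monomial e (coeff e x)) ∈ idealOfVars ℕ (ZMod 2) ^ (n + 1) := by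
    intro e he
    have h := leadToBeta_monomial e
    have hd : Finsupp.weight (fun k => k + 1) e = d := hw (mem_support_iff.1 he)
    rw [show monomial e (coeff e x) = coeff e x • monomial e (1 : ZMod 2) by simp [smul_monomial],
      map_smul, LinearMap.sub_apply, Module.End.one_apply]
    refine ⟨Submodule.smul_mem (weightedHomogeneousSubmodule _ _ _) _
      (h.2.sub (isWeightedHomogeneous_monomial _ _ _ rfl) |> (hd ▸ ·)), ?_⟩
    exact Submodule.smul_of_tower_mem _ _
      (Ideal.pow_le_pow_right (Nat.add_le_add_right (hx e he) 1) h.1)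
  exact ⟨.sum _ _ _ fun e he => (key e he).1, sum_mem fun e he => (key e he).2⟩

theorem eq_zero_of_weight_lt {d n : ℕ} {x : R}
    (hw : IsWeightedHomogeneous (fun k => k + 1) x d) (hx : x ∈ idealOfVars ℕ (ZMod 2) ^ n)
    (h : d < n) : x = 0 := by
  rw [mem_pow_idealOfVars_iff] at hx
  by_contra h0
  obtain ⟨e, he⟩ := support_nonempty.2 h0
  have h1 := hx e he
  have h2 : Finsupp.weight (fun k => k + 1) e = d := hw (mem_support_iff.1 he)
  have h3 : e.degree ≤ Finsupp.weight (fun k => k + 1) e := by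
    rw [Finsupp.weight_apply, Finsupp.degree_apply]
    exact Finset.sum_le_sum fun i _ => by simp [mul_add]
  omega

/-- The weight of an element bounds its lowest total degree, so `leadToBeta - 1`, which preserves
the former and raises the latter, is locally nilpotent. -/
theorem bijective_leadToBeta : Function.Bijective leadToBeta := by
  have h : ∀ x, ∃ n, ((leadToBeta - 1 : Module.End (ZMod 2) R) ^ n) x = 0 := by
    intro x
    suffices x ∈ Module.End.maxGenEigenspace (leadToBeta - 1) 0 by
      simpa [Module.End.mem_maxGenEigenspace] using this
    rw [x.as_sum]
    refine sum_mem fun e _ => ?_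
    rw [Module.End.mem_maxGenEigenspace]
    set d := Finsupp.weight (fun k => k + 1) e
    have key : ∀ n, IsWeightedHomogeneous (fun k => k + 1)
        (((leadToBeta - 1 : Module.End (ZMod 2) R) ^ n) (monomial e (coeff e x))) d ∧
        ((leadToBeta - 1 : Module.End (ZMod 2) R) ^ n) (monomial e (coeff e x)) ∈
          idealOfVars ℕ (ZMod 2) ^ n := by
      intro n
      induction n with
      | zero => simpa using isWeightedHomogeneous_monomial _ _ _ rfl
      | succ n ih =>
        rw [pow_succ', Module.End.mul_apply]
        exact leadToBeta_sub_one_mem ih.1 ih.2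
    refine ⟨d + 1, ?_⟩
    rw [zero_smul, sub_zero]
    exact eq_zero_of_weight_lt (key _).1 (key _).2 (Nat.lt_succ_self d)
  simpa using bijective_one_add_of_locally_nilpotent _ h

/-- The elements `β a M` form a basis of `R` over `𝔽₂`. -/
noncomputable def betaBasis : Module.Basis ((ℕ →₀ ℕ) × Finset ℕ) (ZMod 2) R :=
  leadBasis.map (LinearEquiv.ofBijective leadToBeta bijective_leadToBeta)

theorem betaBasis_apply (p : (ℕ →₀ ℕ) × Finset ℕ) : betaBasis p = β p.1 p.2 := by
  simp [betaBasis, leadToBeta]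

theorem span_beta : Submodule.span (ZMod 2) (Set.range fun p : (ℕ →₀ ℕ) × Finset ℕ => β p.1 p.2)
    = ⊤ := by
  rw [← betaBasis.span_eq]
  congr 1
  ext1
  simp [betaBasis_apply]

theorem f_mul_beta (k : ℕ) (a : ℕ →₀ ℕ) (M : Finset ℕ) :
    f k * β a M = β (a + Finsupp.single k 1) M := by
  rw [β, β, Finsupp.prod_add_index' (by simp) (by simp [pow_add]),
    Finsupp.prod_single_index (by simp)]
  ring

theorem f_pow_mul_beta (k j : ℕ) (a : ℕ →₀ ℕ) (M : Finset ℕ) :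
    f k ^ j * β a M = β (a + Finsupp.single k j) M := by
  induction j with
  | zero => simp
  | succ j ih => rw [pow_succ', mul_assoc, ih, f_mul_beta, add_assoc, ← Finsupp.single_add]

theorem c_mul_beta {k : ℕ} (a : ℕ →₀ ℕ) {M : Finset ℕ} (hk : k ∉ M) :
    c k * β a M = β a (insert k M) := by
  rw [β, β, Finset.prod_insert hk]
  ring

/-! ### The splitting `R = 𝔽₂[f k] {1, c (2k+1)} ⊗ W k` -/

/-- The span of the `β a M` in which neither `f k` nor `c (2 k + 1)` occurs. -/
noncomputable def W (k : ℕ) : Submodule (ZMod 2) R :=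
  Submodule.span (ZMod 2) {x | ∃ a M, a k = 0 ∧ 2 * k + 1 ∉ M ∧ x = β a M}

theorem beta_mem_W {k : ℕ} {a : ℕ →₀ ℕ} {M : Finset ℕ} (ha : a k = 0) (hM : 2 * k + 1 ∉ M) :
    β a M ∈ W k :=
  Submodule.subset_span ⟨a, M, ha, hM, rfl⟩

theorem f_mul_mem_W {k m : ℕ} (hm : m ≠ k) {x : R} (hx : x ∈ W k) : f m * x ∈ W k := by
  induction hx using Submodule.span_induction with
  | mem x hx =>
    obtain ⟨a, M, ha, hM, rfl⟩ := hx
    rw [f_mul_beta]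
    exact beta_mem_W (by simp [ha, hm.symm]) hM
  | zero => simp
  | add x y _ _ hx hy => rw [mul_add]; exact add_mem hx hy
  | smul r x _ hx => rw [mul_smul_comm]; exact Submodule.smul_mem _ _ hx

/-- The difference `c m + ω (c m)`. -/
noncomputable def dc (m : ℕ) : R := if Odd m then f (m / 2) else 0

theorem omega_c (m : ℕ) : omega (c m) = c m + dc m := by
  rcases Nat.even_or_odd' m with ⟨k, rfl | rfl⟩
  · simp [omega_c_even, dc]
  · rw [omega_c_odd, dc, if_pos (by simp), show (2 * k + 1) / 2 = k by omega]

theorem omega_beta (a : ℕ →₀ ℕ) (M : Finset ℕ) :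
    omega (β a M) = a.prod (fun i n => f i ^ n) * ∏ i ∈ M, (c i + dc i) := by
  simp [β, map_mul, map_prod, omega_c, omega_f, Finsupp.prod]

/-- On the `c m` that occur in `W k`, which have `m ≠ 2 k + 1`, the difference `c m + ω (c m)` is
zero or some `f j` with `j ≠ k`. -/
theorem omega_mem_W {k : ℕ} {x : R} (hx : x ∈ W k) : omega x ∈ W k := by
  induction hx using Submodule.span_induction with
  | mem x hx =>
    obtain ⟨a, M, ha, hM, rfl⟩ := hx
    rw [omega_beta, Finset.prod_add, Finset.mul_sum]
    refine sum_mem fun T hT => ?_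
    have hT := Finset.mem_powerset.1 hT
    have h1 : ∀ s : Finset ℕ, s ⊆ M → (∏ i ∈ s, dc i) * β a T ∈ W k := by
      intro s hs
      induction s using Finset.induction_on with
      | empty => simpa using beta_mem_W ha fun h => hM (hT h)
      | insert i s hi ih =>
        rw [Finset.prod_insert hi, mul_assoc]
        have ih := ih fun j hj => hs (Finset.mem_insert_of_mem hj)
        rw [dc]
        split_ifs with ho
        · refine f_mul_mem_W ?_ ih
          rintro rfl
          rw [Nat.two_mul_div_two_add_one_of_odd ho] at hM
          exact hM (hs (Finset.mem_insert_self _ _))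
        · simp
    convert h1 (M \ T) Finset.sdiff_subset using 1
    rw [β]
    ring
  | zero => simp
  | add x y _ _ hx hy => rw [map_add]; exact add_mem hx hy
  | smul r x _ hx => rw [map_smul]; exact Submodule.smul_mem _ _ hx

/-- The projection of `R = 𝔽₂[f k] {1, c (2k+1)} ⊗ W k` onto the elements `c (2k+1) * f k ^ j * v`,
along `W k` and the elements `ω (c (2k+1)) * f k ^ j * v`, where `v` is in `W k`. -/
noncomputable def halfProj (k : ℕ) : R →ₗ[ZMod 2] R :=
  betaBasis.constr (ZMod 2) fun p => if 2 * k + 1 ∈ p.2 then β p.1 p.2 else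
    if p.1 k = 0 then 0 else β (p.1 - Finsupp.single k 1) (insert (2 * k + 1) p.2)

/-- The projection onto `W k` along the multiples of `f k` and of `c (2k+1)`. -/
noncomputable def projW (k : ℕ) : R →ₗ[ZMod 2] R :=
  betaBasis.constr (ZMod 2) fun p => if 2 * k + 1 ∉ p.2 ∧ p.1 k = 0 then β p.1 p.2 else 0

theorem halfProj_beta (k : ℕ) (a : ℕ →₀ ℕ) (M : Finset ℕ) :
    halfProj k (β a M) = if 2 * k + 1 ∈ M then β a M else
    if a k = 0 then 0 else β (a - Finsupp.single k 1) (insert (2 * k + 1) M) := by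
  rw [← betaBasis_apply (a, M), halfProj, Module.Basis.constr_basis]
  simp only [betaBasis_apply]

theorem projW_beta (k : ℕ) (a : ℕ →₀ ℕ) (M : Finset ℕ) :
    projW k (β a M) = if 2 * k + 1 ∉ M ∧ a k = 0 then β a M else 0 := by
  rw [← betaBasis_apply (a, M), projW, Module.Basis.constr_basis]
  simp only [betaBasis_apply]

theorem halfProj_of_mem_W {k : ℕ} {v : R} (hv : v ∈ W k) : halfProj k v = 0 := by
  induction hv using Submodule.span_induction with
  | mem x hx =>
    obtain ⟨a, M, ha, hM, rfl⟩ := hx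
    rw [halfProj_beta, if_neg hM, if_pos ha]
  | zero => simp
  | add x y _ _ hx hy => rw [map_add, hx, hy, add_zero]
  | smul r x _ hx => rw [map_smul, hx, smul_zero]

theorem halfProj_f_pow_mul {k : ℕ} (j : ℕ) {v : R} (hv : v ∈ W k) :
    halfProj k (f k ^ (j + 1) * v) = c (2 * k + 1) * (f k ^ j * v) := by
  induction hv using Submodule.span_induction with
  | mem x hx =>
    obtain ⟨a, M, ha, hM, rfl⟩ := hx
    rw [f_pow_mul_beta, f_pow_mul_beta, c_mul_beta _ hM, halfProj_beta, if_neg hM, if_neg (by simp),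
      Finsupp.single_add, ← add_assoc, add_tsub_cancel_right]
  | zero => simp
  | add x y _ _ hx hy => simp only [mul_add, map_add, hx, hy]
  | smul r x _ hx => simp only [mul_smul_comm, map_smul, hx]

theorem halfProj_c_mul {k : ℕ} (j : ℕ) {v : R} (hv : v ∈ W k) :
    halfProj k (c (2 * k + 1) * (f k ^ j * v)) = c (2 * k + 1) * (f k ^ j * v) := by
  induction hv using Submodule.span_induction with
  | mem x hx =>
    obtain ⟨a, M, ha, hM, rfl⟩ := hx
    rw [f_pow_mul_beta, c_mul_beta _ hM, halfProj_beta, if_pos (by simp)]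
  | zero => simp
  | add x y _ _ hx hy => simp only [mul_add, map_add, hx, hy]
  | smul r x _ hx => simp only [mul_smul_comm, map_smul, hx]

/-- The elements `β a M` with `f k` or `c (2k+1)` among their factors span a free
`𝔽₂[C₂]`-module, on which the projection `halfProj k` and its conjugate under `ω` add up to the
identity. -/
theorem halfProj_add_conj (k : ℕ) (x : R) :
    halfProj k x + omega (halfProj k (omega x)) = x + projW k x := by
  have hx : x ∈ Submodule.span (ZMod 2) (Set.range fun p : (ℕ →₀ ℕ) × Finset ℕ => β p.1 p.2) :=
    span_beta ▸ Submodule.mem_top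
  induction hx using Submodule.span_induction with
  | mem x hx =>
    obtain ⟨⟨a, M⟩, rfl⟩ := hx
    dsimp only
    have hN : 2 * k + 1 ∉ M.erase (2 * k + 1) := Finset.notMem_erase _ _
    have ha : a = a.erase k + Finsupp.single k (a k) := (Finsupp.erase_add_single k a).symm
    by_cases hM : 2 * k + 1 ∈ M
    · have hv : β (a.erase k) (M.erase (2 * k + 1)) ∈ W k := beta_mem_W (by simp) hN
      have e : β a M = c (2 * k + 1) * (f k ^ a k * β (a.erase k) (M.erase (2 * k + 1))) := by
        rw [f_pow_mul_beta, ← ha, c_mul_beta _ hN, Finset.insert_erase hM]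
      -- The second term vanishes, since `ω (c (2k+1)) * f k ^ j * ω v` is in the kernel.
      rw [projW_beta, if_neg (by simp [hM]), e, halfProj_c_mul _ hv]
      simp only [map_mul, map_pow, omega_f, omega_c_odd, add_mul]
      rw [← mul_assoc (f k), ← pow_succ', map_add, halfProj_c_mul _ (omega_mem_W hv),
        halfProj_f_pow_mul _ (omega_mem_W hv), CharTwo.add_self_eq_zero, map_zero]
    · by_cases h0 : a k = 0
      · have hv : β a M ∈ W k := beta_mem_W h0 hM
        rw [projW_beta, if_pos ⟨hM, h0⟩, halfProj_of_mem_W hv, halfProj_of_mem_W (omega_mem_W hv),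
          map_zero, add_zero, CharTwo.add_self_eq_zero]
      · obtain ⟨j, hj⟩ := Nat.exists_eq_succ_of_ne_zero h0
        have hv : β (a.erase k) M ∈ W k := beta_mem_W (by simp) hM
        have e : β a M = f k ^ (j + 1) * β (a.erase k) M := by
          rw [f_pow_mul_beta, ← Nat.succ_eq_add_one, ← hj, ← ha]
        -- As `f k = c (2k+1) + ω (c (2k+1))`, the two terms are the parts of `f k * f k ^ j * v`.
        rw [projW_beta, if_neg (by simp [h0]), e, halfProj_f_pow_mul _ hv]
        simp only [map_mul, map_pow, omega_f]
        rw [halfProj_f_pow_mul _ (omega_mem_W hv)]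
        simp only [map_mul, map_pow, omega_f, omega_c_odd, omega_involutive _]
        linear_combination (CharTwo.add_self_eq_zero
          (c (2 * k + 1) * (f k ^ j * β (a.erase k) M)))
  | zero => simp
  | add x y _ _ hx hy => simp only [map_add]; linear_combination hx + hy
  | smul r x _ hx => simp only [map_smul, ← smul_add, hx]

/-! ### Powers of the ideal `R I` -/

/-- The map `x ↦ x + ω x` sends `A Iⁿ` to `Iⁿ⁺¹`. -/
theorem add_apply_mem_diffIdeal_pow {A : Type*} [CommRing A] [Algebra (ZMod 2) A]
    {ω : A →ₐ[ZMod 2] A} (hω : Function.Involutive ω) {n : ℕ} {y : A}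
    (hy : y ∈ (diffIdeal ω ^ n).map (algebraMap (invariants ω) A)) :
    (⟨y + ω y, add_apply_mem_invariants hω y⟩ : invariants ω) ∈ diffIdeal ω ^ (n + 1) := by
  suffices ∀ r : A, (⟨r * y + ω (r * y), add_apply_mem_invariants hω _⟩ : invariants ω) ∈
      diffIdeal ω ^ (n + 1) by simpa using this 1
  induction hy using Submodule.span_induction with
  | mem y hy =>
    obtain ⟨i, hi, rfl⟩ := hy
    intro r
    have h1 : (⟨r + ω r, add_apply_mem_invariants hω r⟩ : invariants ω) ∈ diffIdeal ω := ⟨r, rfl⟩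
    rw [pow_succ]
    convert Ideal.mul_mem_mul hi h1 using 1
    have h2 : ω (i : A) = i := i.2
    ext
    change r * (i : A) + ω (r * (i : A)) = i * (r + ω r)
    rw [map_mul, h2]
    ring
  | zero =>
    intro r
    rw [show (⟨r * 0 + ω (r * 0), add_apply_mem_invariants hω _⟩ : invariants ω) = 0 by
      ext; simp]
    exact zero_mem _
  | add x y _ _ hx hy =>
    intro r
    convert add_mem (hx r) (hy r) using 1
    ext
    simp only [mul_add, map_add, Subalgebra.coe_add]
    ring
  | smul a x _ hx =>
    intro r
    convert hx (r * a) using 3 <;> simp [mul_assoc]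

/-- The ideal `R I` of `R`. -/
noncomputable def J : Ideal R := (diffIdeal omega).map (algebraMap (invariants omega) R)

theorem f_mem_J (k : ℕ) : f k ∈ J := by
  have h : (⟨f k, omega_f k⟩ : invariants omega) ∈ diffIdeal omega := ⟨c (2 * k + 1), ?_⟩
  · exact Ideal.mem_map_of_mem (algebraMap (invariants omega) R) h
  change f k = _
  rw [omega_c_odd, ← add_assoc, CharTwo.add_self_eq_zero, zero_add]

theorem beta_mem_J_pow {n : ℕ} {a : ℕ →₀ ℕ} (h : n ≤ a.degree) (M : Finset ℕ) :
    β a M ∈ J ^ n := by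
  refine Ideal.mul_mem_right _ _ (Ideal.pow_le_pow_right h ?_)
  rw [Finsupp.degree_apply, ← Finset.prod_pow_eq_pow_sum]
  exact Ideal.prod_mem_prod fun i _ => Ideal.pow_mem_pow (f_mem_J i) _

/-- Modulo the `f k`, the involution fixes every `β a M`. -/
theorem J_le : J ≤ Ideal.span (Set.range f) := by
  rw [J, Ideal.map_le_iff_le_comap]
  rintro ⟨s, hs⟩ ⟨x, rfl : s = x + omega x⟩
  change x + omega x ∈ Ideal.span (Set.range f)
  have hf (k : ℕ) : f k ∈ Ideal.span (Set.range f) := Ideal.subset_span ⟨k, rfl⟩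
  have hx : x ∈ Submodule.span (ZMod 2) (Set.range fun p : (ℕ →₀ ℕ) × Finset ℕ => β p.1 p.2) :=
    span_beta ▸ Submodule.mem_top
  clear hs
  induction hx using Submodule.span_induction with
  | mem x hx =>
    obtain ⟨⟨a, M⟩, rfl⟩ := hx
    dsimp only
    rw [omega_beta, β, ← mul_add]
    refine Ideal.mul_mem_left _ _ ?_
    rw [← CharTwo.sub_eq_add, ← Ideal.Quotient.eq, map_prod, map_prod]
    refine Finset.prod_congr rfl fun i _ => ?_
    rw [Ideal.Quotient.eq, sub_add_cancel_left, neg_mem_iff, dc]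
    split_ifs
    exacts [hf _, zero_mem _]
  | zero => simp
  | add x y _ _ hx hy => rw [map_add, add_add_add_comm]; exact add_mem hx hy
  | smul r x _ hx => rw [map_smul, ← smul_add]; exact Submodule.smul_of_tower_mem _ _ hx

/-- The span of the `β a M` with at least `n` factors `f k`, all of them with `k < N`. -/
noncomputable def betaSpan (n N : ℕ) : Submodule (ZMod 2) R :=
  Submodule.span (ZMod 2) {x | ∃ a M, n ≤ a.degree ∧ (∀ k ≥ N, a k = 0) ∧ x = β a M}

theorem beta_mem_betaSpan {n N : ℕ} {a : ℕ →₀ ℕ} (M : Finset ℕ) (h : n ≤ a.degree)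
    (ha : ∀ k ≥ N, a k = 0) : β a M ∈ betaSpan n N :=
  Submodule.subset_span ⟨a, M, h, ha, rfl⟩

theorem betaSpan_mono {n N N' : ℕ} (h : N ≤ N') : betaSpan n N ≤ betaSpan n N' :=
  Submodule.span_mono fun _ ⟨a, M, h1, h2, h3⟩ => ⟨a, M, h1, fun k hk => h2 k (h.trans hk), h3⟩

theorem exists_add_mem_betaSpan {n : ℕ} {x y : R} (hx : ∃ N, x ∈ betaSpan n N)
    (hy : ∃ N, y ∈ betaSpan n N) : ∃ N, x + y ∈ betaSpan n N := by
  obtain ⟨N, hx⟩ := hx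
  obtain ⟨N', hy⟩ := hy
  exact ⟨max N N', add_mem (betaSpan_mono (le_max_left _ _) hx)
    (betaSpan_mono (le_max_right _ _) hy)⟩

theorem f_mul_mem_betaSpan {n N : ℕ} (k : ℕ) {x : R} (hx : x ∈ betaSpan n N) :
    f k * x ∈ betaSpan (n + 1) (max N (k + 1)) := by
  induction hx using Submodule.span_induction with
  | mem x hx =>
    obtain ⟨a, M, h, ha, rfl⟩ := hx
    rw [f_mul_beta]
    refine beta_mem_betaSpan M (by simpa using h) fun j hj => ?_
    have h1 : k ≠ j := by have := le_max_right N (k + 1); omega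
    simp [ha j ((le_max_left _ _).trans hj), h1]
  | zero => simp
  | add x y _ _ hx hy => rw [mul_add]; exact add_mem hx hy
  | smul r x _ hx => rw [mul_smul_comm]; exact Submodule.smul_mem _ _ hx

/-- The ideal `R Iⁿ` lies in the span of the `β a M` with at least `n` factors `f k`. -/
theorem exists_mem_betaSpan {n : ℕ} {x : R} (hx : x ∈ J ^ n) : ∃ N, x ∈ betaSpan n N := by
  induction n generalizing x with
  | zero =>
    clear hx
    have hx : x ∈ Submodule.span (ZMod 2) (Set.range fun p : (ℕ →₀ ℕ) × Finset ℕ => β p.1 p.2) :=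
      span_beta ▸ Submodule.mem_top
    induction hx using Submodule.span_induction with
    | mem x hx =>
      obtain ⟨⟨a, M⟩, rfl⟩ := hx
      refine ⟨a.support.sup id + 1, beta_mem_betaSpan M (Nat.zero_le _) fun k hk => ?_⟩
      by_contra h0
      have := Finset.le_sup (f := id) (Finsupp.mem_support_iff.2 h0)
      simp only [id] at this
      omega
    | zero => exact ⟨0, zero_mem _⟩
    | add x y _ _ hx hy => exact exists_add_mem_betaSpan hx hy
    | smul r x _ hx =>
      obtain ⟨N, h⟩ := hx
      exact ⟨N, Submodule.smul_mem _ _ h⟩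
  | succ n ih =>
    have hx := Ideal.mul_mono_left J_le (pow_succ' J n ▸ hx)
    refine Submodule.mul_induction_on hx (fun r hr s hs => ?_) fun _ _ => exists_add_mem_betaSpan
    induction hr using Submodule.span_induction generalizing s with
    | mem r hr =>
      obtain ⟨k, rfl⟩ := hr
      obtain ⟨N, h⟩ := ih hs
      exact ⟨_, f_mul_mem_betaSpan k h⟩
    | zero => exact ⟨0, by simp⟩
    | add x y _ _ hx hy => rw [add_mul]; exact exists_add_mem_betaSpan (hx s hs) (hy s hs)
    | smul a x _ hx =>
      rw [smul_mul_assoc, ← mul_smul_comm]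
      exact hx _ (Ideal.mul_mem_left _ _ hs)

theorem halfProj_mem_J_pow {n N : ℕ} (k : ℕ) {x : R} (hx : x ∈ betaSpan (n + 1) N) :
    halfProj k x ∈ J ^ n := by
  induction hx using Submodule.span_induction with
  | mem x hx =>
    obtain ⟨a, M, h, ha, rfl⟩ := hx
    rw [halfProj_beta]
    split_ifs with h1 h2
    · exact beta_mem_J_pow (by omega) _
    · exact zero_mem _
    · have h3 : (a - Finsupp.single k 1) + Finsupp.single k 1 = a :=
        tsub_add_cancel_of_le (by simpa using Nat.one_le_iff_ne_zero.2 h2)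
      refine beta_mem_J_pow ?_ _
      rw [← h3, map_add, Finsupp.degree_single] at h
      omega
  | zero => simp
  | add x y _ _ hx hy => rw [map_add]; exact add_mem hx hy
  | smul r x _ hx => rw [map_smul]; exact Submodule.smul_of_tower_mem _ _ hx

theorem projW_mem_betaSpan {n N : ℕ} {x : R} (hx : x ∈ betaSpan n (N + 1)) :
    projW N x ∈ betaSpan n N := by
  induction hx using Submodule.span_induction with
  | mem x hx =>
    obtain ⟨a, M, h, ha, rfl⟩ := hx
    rw [projW_beta]
    split_ifs with h1
    · refine beta_mem_betaSpan M h fun k hk => ?_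
      rcases hk.eq_or_lt with rfl | hk
      exacts [h1.2, ha k hk]
    · exact zero_mem _
  | zero => simp
  | add x y _ _ hx hy => rw [map_add]; exact add_mem hx hy
  | smul r x _ hx => rw [map_smul]; exact Submodule.smul_mem _ _ hx

/-! ### Transversality -/

/-- For `y = halfProj N s`, the element `y + ω y` accounts for the part of an invariant `s` outside
`W N`, and what is left has only factors `f k` with `k < N`. -/
theorem mem_diffIdeal_pow_of_mem_betaSpan {n N : ℕ} (s : invariants omega)
    (hs : (s : R) ∈ betaSpan (n + 1) N) : s ∈ diffIdeal omega ^ (n + 1) := by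
  induction N generalizing s with
  | zero =>
    -- There is no product of at least one of the `f k` with `k < 0`.
    have h0 : betaSpan (n + 1) 0 = ⊥ := by
      rw [betaSpan, Submodule.span_eq_bot]
      rintro x ⟨a, M, h, ha, rfl⟩
      have : a = 0 := by ext k; exact ha k (Nat.zero_le _)
      simp [this] at h
    rw [h0, Submodule.mem_bot] at hs
    rw [show s = 0 from Subtype.ext hs]
    exact zero_mem _
  | succ N ih =>
    have hy : halfProj N (s : R) ∈ (diffIdeal omega ^ n).map (algebraMap (invariants omega) R) := by
      rw [Ideal.map_pow]
      exact halfProj_mem_J_pow N hs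
    have h1 := halfProj_add_conj N (s : R)
    rw [show omega (s : R) = s from s.2] at h1
    set t : invariants omega :=
      ⟨_, add_apply_mem_invariants omega_involutive (halfProj N (s : R))⟩
    have h2 : ((s - t : invariants omega) : R) = projW N (s : R) := by
      rw [Subalgebra.coe_sub, CharTwo.sub_eq_add]
      change (s : R) + (halfProj N (s : R) + omega (halfProj N (s : R))) = _
      rw [h1, ← add_assoc, CharTwo.add_self_eq_zero, zero_add]
    rw [← sub_add_cancel s t]
    exact add_mem (ih _ (h2 ▸ projW_mem_betaSpan hs))
      (add_apply_mem_diffIdeal_pow omega_involutive hy)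

/-- The involution `ω` is `n`-transverse for every `n`. -/
theorem isNTransverse_omega (n : ℕ) : IsNTransverse omega n := by
  refine le_antisymm (fun s hs => ?_) Ideal.le_comap_map
  cases n with
  | zero => simp
  | succ n =>
    rw [Ideal.mem_comap, Ideal.map_pow] at hs
    obtain ⟨N, h⟩ := exists_mem_betaSpan hs
    exact mem_diffIdeal_pow_of_mem_betaSpan s h

end ThickDiff

theorem mainTheorem4 : ThickDiff.IsNTransverse ThickDiff.omega 2 := by
  exact ThickDiff.isNTransverse_omega 2
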